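/- Let \(\mathbb{H}\) be the upper half plane, and let \(M\in \mathrm{SL}_3(\mathbb{Z})\) have eigenvalues \(\alpha,\beta,\overline{\beta}\) with \(\alpha\in\mathbb{R}\), \(\alpha>1\) and \(\beta\neq\overline{\beta}\). Let \((a_1,a_2,a_3)^T\in\mathbb{R}^3\) be an eigenvector of \(M\) for \(\alpha\) and \((b_1,b_2,b_3)^T\in\mathbb{C}^3\) an eigenvector of \(M\) for \(\beta\). Let \(G_M\) be the group of holomorphic automorphisms of \(\mathbb{H}\times\mathbb{C}\) generated by \(g_0(w,z)=(\alpha w,\beta z)\) and \(g_i(w,z)=(w+a_i,z+b_i)\), \(i=1,2,3\); it acts freely and properly discontinuously. Let \(X=(\mathbb{H}\times\mathbb{C})/G_M\) be the quotient complex surface (an Inoue surface of type \(S_M\)), with quotient map \(\pi\), and let \(\mathrm{Aut}(X)\) be its group of holomorphic automorphisms. Then: 1. \(\mathrm{Aut}(X)\) is solvable. 2. Every subgroup \(G\leq \mathrm{Aut}(X)\) has virtual derived length at most \(2\), that is, \(G\) has a solvable subgroup of finite index of derived length at most \(2\). (The derived length of a solvable group \(H\) is the least \(n\ge 0\) with \(H^{(n)}=1\),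 and the virtual derived length is the minimum of the derived lengths of the solvable subgroups of finite index.) 3. Every \(f\in\mathrm{Aut}(X)\) has a lift, that is, a holomorphic automorphism \(u\) of \(\mathbb{H}\times\mathbb{C}\) with \(\pi\circ u=f\circ\pi\). A holomorphic automorphism of \(\mathbb{H}\times\mathbb{C}\) is a lift of some element of \(\mathrm{Aut}(X)\) if and only if it normalises \(G_M\), and every lift has the form \((w,z)\mapsto(aw+b,\,Az+B)\) with \(a,b\in\mathbb{R}\), \(a>0\), \(A,B\in\mathbb{C}\), \(A\neq 0\). -/

import Mathlib

open scoped Manifold ContDiff UpperHalfPlane Matrix ComplexConjugate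

noncomputable section

/-! ### Derived length and virtual derived length -/

/-- The derived length of a group: the least `n` with `G⁽ⁿ⁾ = 1`, and `⊤` if there is no such `n`
(that is, if `G` is not solvable). -/
def derivedLength (G : Type*) [Group G] : ℕ∞ :=
  ⨅ (n : ℕ) (_ : derivedSeries G n = ⊥), (n : ℕ∞)

/-- The virtual derived length of a group: the least derived length of a subgroup of finite index.
It is `⊤` exactly if `G` is not virtually solvable. -/
def virtualDerivedLength (G : Type*) [Group G] : ℕ∞ :=
  ⨅ (H : Subgroup G) (_ : H.FiniteIndex), derivedLength H

/-! ### The group of holomorphic automorphisms of a complex manifold -/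

/-- Biholomorphic self-maps of `X`. Over `ℂ`, the smoothness order `ω` means holomorphic. -/
abbrev HolAut {E H : Type*} [NormedAddCommGroup E] [NormedSpace ℂ E] [TopologicalSpace H]
    (I : ModelWithCorners ℂ E H) (X : Type*) [TopologicalSpace X] [ChartedSpace H X] : Type _ :=
  Diffeomorph I I X X ω

namespace HolAut

variable {E H : Type*} [NormedAddCommGroup E] [NormedSpace ℂ E] [TopologicalSpace H]
  {I : ModelWithCorners ℂ E H} {X : Type*} [TopologicalSpace X] [ChartedSpace H X]

/-- The group structure on `Aut(X)` given by composition, `(f * g) x = f (g x)`. -/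
instance : Group (HolAut I X) where
  mul f g := Diffeomorph.trans g f
  one := Diffeomorph.refl I X ω
  inv f := Diffeomorph.symm f
  mul_assoc _ _ _ := rfl
  one_mul _ := rfl
  mul_one _ := rfl
  inv_mul_cancel f := Diffeomorph.ext fun x => f.symm_apply_apply x

/-- `Aut(X)` acts on `X` by evaluation. -/
instance : MulAction (HolAut I X) X where
  smul f x := f x
  one_smul _ := rfl
  mul_smul _ _ _ := rfl

instance : ContinuousConstSMul (HolAut I X) X where
  continuous_const_smul f := Diffeomorph.continuous f

theorem smul_def (f : HolAut I X) (x : X) : f • x = f x := rfl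

end HolAut

/-! ### The complex manifold `W = ℍ × ℂ` and its affine automorphisms -/

/-- The model with corners of complex surfaces modelled on `ℂ × ℂ`. -/
abbrev modelC2 : ModelWithCorners ℂ (ℂ × ℂ) (ModelProd ℂ ℂ) := 𝓘(ℂ).prod 𝓘(ℂ)

/-- The product of the upper half plane and the complex line. -/
abbrev HalfPlaneProd : Type := ℍ × ℂ

/-- The map `w ↦ a w + b` of the upper half plane, for real `a > 0` and `b`. -/
def halfPlaneAffine (a : ℝ) (ha : 0 < a) (b : ℝ) (w : ℍ) : ℍ :=
  ⟨(a : ℂ) * (w : ℂ) + (b : ℂ), by simpa using mul_pos ha w.im_pos⟩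

theorem coe_halfPlaneAffine (a : ℝ) (ha : 0 < a) (b : ℝ) (w : ℍ) :
    (halfPlaneAffine a ha b w : ℂ) = a * w + b := rfl

theorem contMDiff_halfPlaneAffine (a : ℝ) (ha : 0 < a) (b : ℝ) :
    ContMDiff 𝓘(ℂ) 𝓘(ℂ) ω (halfPlaneAffine a ha b) := by
  have h1 : ContMDiff 𝓘(ℂ) 𝓘(ℂ) ω (fun w : ℍ => (a : ℂ) * (w : ℂ) + (b : ℂ)) :=
    (contMDiff_const.mul UpperHalfPlane.contMDiff_coe).add contMDiff_const
  have hc : Continuous (halfPlaneAffine a ha b) :=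
    UpperHalfPlane.isOpenEmbedding_coe.isEmbedding.continuous_iff.2 h1.continuous
  intro w
  refine contMDiffAt_iff_target.mpr ⟨hc.continuousAt, ?_⟩
  exact h1 w

/-- The automorphism `(w, z) ↦ (a w + b, A z + B)` of `ℍ × ℂ`, for real `a > 0`, `b` and
complex `A ≠ 0`, `B`. -/
def affineAut (a : ℝ) (ha : 0 < a) (b : ℝ) (A : ℂ) (hA : A ≠ 0) (B : ℂ) :
    HolAut modelC2 HalfPlaneProd where
  toFun p := (halfPlaneAffine a ha b p.1, A * p.2 + B)
  invFun p := (halfPlaneAffine a⁻¹ (inv_pos.2 ha) (-(a⁻¹ * b)) p.1, A⁻¹ * p.2 + -(A⁻¹ * B))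
  left_inv p := by
    have ha' : (a : ℂ) ≠ 0 := by exact_mod_cast ha.ne'
    refine Prod.ext (UpperHalfPlane.ext ?_) ?_
    · simp only [coe_halfPlaneAffine]; push_cast; field_simp; ring
    · simp only; field_simp; ring
  right_inv p := by
    have ha' : (a : ℂ) ≠ 0 := by exact_mod_cast ha.ne'
    refine Prod.ext (UpperHalfPlane.ext ?_) ?_
    · simp only [coe_halfPlaneAffine]; push_cast; field_simp; ring
    · simp only; field_simp; ring
  contMDiff_toFun :=
    ((contMDiff_halfPlaneAffine a ha b).comp contMDiff_fst).prodMk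
      ((contMDiff_const.mul contMDiff_snd).add contMDiff_const)
  contMDiff_invFun :=
    ((contMDiff_halfPlaneAffine a⁻¹ (inv_pos.2 ha) (-(a⁻¹ * b))).comp contMDiff_fst).prodMk
      ((contMDiff_const.mul contMDiff_snd).add contMDiff_const)

theorem affineAut_apply (a : ℝ) (ha : 0 < a) (b : ℝ) (A : ℂ) (hA : A ≠ 0) (B : ℂ)
    (p : HalfPlaneProd) :
    affineAut a ha b A hA B p = (halfPlaneAffine a ha b p.1, A * p.2 + B) := rfl

/-! ### Inoue surfaces of type `S_M` -/

/-- The data defining an Inoue surface of type `S_M`: a matrix `M ∈ SL₃(ℤ)` with a real eigenvalue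
`α > 1` and a non-real eigenvalue `β` (the eigenvalues of the real matrix `M` are then exactly
`α, β, conj β`), a real eigenvector `a` for `α`, and an eigenvector `b` for `β`. -/
structure InoueSMData where
  M : Matrix.SpecialLinearGroup (Fin 3) ℤ
  α : ℝ
  β : ℂ
  one_lt_α : 1 < α
  β_ne_conj : β ≠ conj β
  a : Fin 3 → ℝ
  a_ne_zero : a ≠ 0
  mulVec_a : (M.1.map (Int.cast : ℤ → ℝ)) *ᵥ a = α • a
  b : Fin 3 → ℂ
  b_ne_zero : b ≠ 0
  mulVec_b : (M.1.map (Int.cast : ℤ → ℂ)) *ᵥ b = β • b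

namespace InoueSMData

variable (D : InoueSMData)

theorem α_pos : 0 < D.α := zero_lt_one.trans D.one_lt_α

theorem β_ne_zero : D.β ≠ 0 := fun h => D.β_ne_conj (by simp [h])

/-- `g₀ (w, z) = (α w, β z)`. -/
def g₀ : HolAut modelC2 HalfPlaneProd := affineAut D.α D.α_pos 0 D.β D.β_ne_zero 0

/-- `gᵢ (w, z) = (w + aᵢ, z + bᵢ)`. -/
def g (i : Fin 3) : HolAut modelC2 HalfPlaneProd :=
  affineAut 1 one_pos (D.a i) 1 one_ne_zero (D.b i)

/-- The group `G_M` of automorphisms of `ℍ × ℂ` generated by `g₀, g₁, g₂, g₃`. -/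
def deckGroup : Subgroup (HolAut modelC2 HalfPlaneProd) :=
  Subgroup.closure (insert D.g₀ (Set.range D.g))

/-! The action of `G_M` is free and properly discontinuous; this is what makes the quotient a
complex manifold. -/

/-- The real-linear map `x ↦ (∑ xᵢ aᵢ, ∑ xᵢ bᵢ)`. -/
def latticeMap : (Fin 3 → ℝ) →ₗ[ℝ] ℝ × ℂ where
  toFun x := (∑ i, x i * D.a i, ∑ i, (x i : ℂ) * D.b i)
  map_add' x y := by
    simp [add_mul, Finset.sum_add_distrib]
  map_smul' c x := by
    simp [mul_assoc, Finset.mul_sum]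

theorem latticeMap_ker : D.latticeMap.ker = ⊥ := by
  rw [LinearMap.ker_eq_bot']
  intro x hx
  have h1 : ∑ i, x i * D.a i = 0 := congrArg Prod.fst hx
  have h2 : ∑ i, (x i : ℂ) * D.b i = 0 := congrArg Prod.snd hx
  -- the three complex eigenvectors
  let MC : Matrix (Fin 3) (Fin 3) ℂ := D.M.1.map (Int.cast : ℤ → ℂ)
  let v : Fin 3 → (Fin 3 → ℂ) := ![fun i => (D.a i : ℂ), D.b, fun i => conj (D.b i)]
  let μ : Fin 3 → ℂ := ![(D.α : ℂ), D.β, conj D.β]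
  have hv : ∀ j, Module.End.HasEigenvector (Matrix.toLin' MC) (μ j) (v j) := by
    intro j
    rw [Module.End.hasEigenvector_iff, Module.End.mem_eigenspace_iff, Matrix.toLin'_apply]
    fin_cases j
    · constructor
      · funext i
        have := congrArg (fun t : ℝ => (t : ℂ)) (congrFun D.mulVec_a i)
        simpa [Matrix.mulVec, dotProduct, MC, v, μ] using this
      · intro h
        apply D.a_ne_zero
        funext i
        have := congrFun h i
        simpa [v] using this
    · exact ⟨D.mulVec_b, D.b_ne_zero⟩
    · constructor
      · funext i
        have := congrArg (starRingEnd ℂ) (congrFun D.mulVec_b i)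
        simpa [Matrix.mulVec, dotProduct, MC, v, μ] using this
      · intro h
        apply D.b_ne_zero
        funext i
        have := congrFun h i
        simpa [v] using this
  have hαβ : (D.α : ℂ) ≠ D.β := fun h => D.β_ne_conj (by rw [← h, Complex.conj_ofReal])
  have hαβ' : (D.α : ℂ) ≠ conj D.β := fun h => hαβ (by
    have := congrArg (starRingEnd ℂ) h
    simpa using this)
  have hμ : Function.Injective μ := by
    intro i j hij
    fin_cases i <;> fin_cases j <;> simp [μ] at hij ⊢
    · exact hαβ hij
    · exact hαβ' hij
    · exact hαβ hij.symm
    · exact D.β_ne_conj hij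
    · exact hαβ' hij.symm
    · exact D.β_ne_conj hij.symm
  have hli : LinearIndependent ℂ v :=
    Module.End.eigenvectors_linearIndependent' (Matrix.toLin' MC) μ hμ v hv
  have hspan : Submodule.span ℂ (Set.range v) = ⊤ :=
    hli.span_eq_top_of_card_eq_finrank (by simp)
  let φ : (Fin 3 → ℂ) →ₗ[ℂ] ℂ :=
    ∑ i, (x i : ℂ) • LinearMap.proj (R := ℂ) (φ := fun _ : Fin 3 => ℂ) i
  have hφ : ∀ y, φ y = ∑ i, (x i : ℂ) * y i := by intro y; simp [φ]
  have hφ0 : φ = 0 := by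
    refine LinearMap.ext_on_range hspan fun j => ?_
    rw [hφ, LinearMap.zero_apply]
    fin_cases j
    · have := congrArg (fun t : ℝ => (t : ℂ)) h1
      simpa [v] using this
    · exact h2
    · have := congrArg (starRingEnd ℂ) h2
      simpa [v] using this
  funext i
  have := LinearMap.congr_fun hφ0 (Pi.single i 1)
  rw [hφ] at this
  simpa [Pi.single_apply] using this

theorem latticeMap_vecMul (n : Fin 3 → ℤ) :
    D.latticeMap (fun i => (n ᵥ* D.M.1) i) =
      (D.α * (D.latticeMap (fun i => n i)).1, D.β * (D.latticeMap (fun i => n i)).2) := by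
  have ha : ∀ i, D.α * D.a i = ∑ j, (D.M.1 i j : ℝ) * D.a j := fun i => by
    have := congrFun D.mulVec_a i
    simpa [Matrix.mulVec, dotProduct] using this.symm
  have hb : ∀ i, D.β * D.b i = ∑ j, (D.M.1 i j : ℂ) * D.b j := fun i => by
    have := congrFun D.mulVec_b i
    simpa [Matrix.mulVec, dotProduct] using this.symm
  refine Prod.ext ?_ ?_
  · simp only [latticeMap, LinearMap.coe_mk, AddHom.coe_mk, Matrix.vecMul, dotProduct,
      Finset.mul_sum]
    have : ∀ i, D.α * ((n i : ℝ) * D.a i) = ∑ j, (n i : ℝ) * ((D.M.1 i j : ℝ) * D.a j) := by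
      intro i
      rw [← Finset.mul_sum, ← ha]; ring
    simp only [this]
    rw [Finset.sum_comm]
    refine Finset.sum_congr rfl fun j _ => ?_
    push_cast
    rw [Finset.sum_mul]
    exact Finset.sum_congr rfl fun i _ => by ring
  · simp only [latticeMap, LinearMap.coe_mk, AddHom.coe_mk, Matrix.vecMul, dotProduct,
      Finset.mul_sum]
    have : ∀ i, D.β * (((n i : ℝ) : ℂ) * D.b i)
        = ∑ j, (n i : ℂ) * ((D.M.1 i j : ℂ) * D.b j) := by
      intro i
      rw [← Finset.mul_sum, ← hb]; push_cast; ring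
    simp only [this]
    rw [Finset.sum_comm]
    refine Finset.sum_congr rfl fun j _ => ?_
    push_cast
    rw [Finset.sum_mul]
    exact Finset.sum_congr rfl fun i _ => by ring

theorem exists_inv_mul_latticeMap (n : Fin 3 → ℤ) : ∃ m : Fin 3 → ℤ,
    D.latticeMap (fun i => m i) =
      (D.α⁻¹ * (D.latticeMap (fun i => n i)).1, D.β⁻¹ * (D.latticeMap (fun i => n i)).2) := by
  obtain ⟨m, hm⟩ : ∃ m : Fin 3 → ℤ, m ᵥ* D.M.1 = n :=
    ⟨n ᵥ* (D.M⁻¹).1, by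
      rw [Matrix.vecMul_vecMul, ← Matrix.SpecialLinearGroup.coe_mul, inv_mul_cancel]; simp⟩
  refine ⟨m, ?_⟩
  rw [← hm, D.latticeMap_vecMul m, ← mul_assoc, ← mul_assoc, inv_mul_cancel₀ D.α_pos.ne',
    inv_mul_cancel₀ D.β_ne_zero, one_mul, one_mul]

/-- Every element of `G_M` has the form `(w, z) ↦ (αᵏ w + ∑ nᵢ aᵢ, βᵏ z + ∑ nᵢ bᵢ)`. -/
theorem exists_normal_form (γ : D.deckGroup) : ∃ (k : ℤ) (n : Fin 3 → ℤ),
    ∀ p : HalfPlaneProd,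
      (((γ • p).1 : ℍ) : ℂ) = (D.α : ℂ) ^ k * p.1 + ((D.latticeMap (fun i => n i)).1 : ℂ) ∧
      (γ • p).2 = D.β ^ k * p.2 + (D.latticeMap (fun i => n i)).2 := by
  have hα : (D.α : ℂ) ≠ 0 := by exact_mod_cast D.α_pos.ne'
  obtain ⟨γ, hγ⟩ := γ
  change ∃ (k : ℤ) (n : Fin 3 → ℤ), ∀ p : HalfPlaneProd,
      (((γ p).1 : ℍ) : ℂ) = (D.α : ℂ) ^ k * p.1 + ((D.latticeMap (fun i => n i)).1 : ℂ) ∧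
      (γ p).2 = D.β ^ k * p.2 + (D.latticeMap (fun i => n i)).2
  induction hγ using Subgroup.closure_induction_left with
  | one => exact ⟨0, 0, fun p => by
      have h0 : D.latticeMap (fun i => ((0 : Fin 3 → ℤ) i : ℝ)) = 0 := by
        simpa [Pi.zero_def] using D.latticeMap.map_zero
      rw [h0]
      constructor
      · change (p.1 : ℂ) = _
        simp
      · change p.2 = _
        simp⟩
  | mul_left x hx y hy ih =>
    obtain ⟨k, n, h⟩ := ih
    rcases hx with rfl | ⟨i, rfl⟩
    · refine ⟨k + 1, n ᵥ* D.M.1, fun p => ?_⟩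
      rw [D.latticeMap_vecMul]
      constructor
      · change (D.α : ℂ) * ((y p).1 : ℂ) + ((0 : ℝ) : ℂ) = _
        rw [(h p).1, zpow_add_one₀ hα]; push_cast; ring
      · change D.β * (y p).2 + 0 = _
        rw [(h p).2, zpow_add_one₀ D.β_ne_zero]; ring
    · refine ⟨k, Pi.single i 1 + n, fun p => ?_⟩
      have hs : D.latticeMap (fun j => ((Pi.single i 1 + n : Fin 3 → ℤ) j : ℝ)) =
          (D.a i, D.b i) + D.latticeMap (fun j => n j) := by
        have h1 : (fun j => ((Pi.single i 1 + n : Fin 3 → ℤ) j : ℝ)) =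
            Pi.single i 1 + fun j => (n j : ℝ) := by
          funext j
          by_cases hj : j = i
          · subst hj; simp
          · simp [hj]
        rw [h1, map_add]
        congr 1
        refine Prod.ext ?_ ?_ <;> simp [latticeMap, Pi.single_apply, apply_ite Complex.ofReal]
      rw [hs]
      constructor
      · change ((1 : ℝ) : ℂ) * ((y p).1 : ℂ) + (D.a i : ℂ) = _
        rw [(h p).1]; simp only [Prod.fst_add]; push_cast; ring
      · change (1 : ℂ) * (y p).2 + D.b i = _
        rw [(h p).2]; simp only [Prod.snd_add]; ring
  | inv_mul_cancel x hx y hy ih =>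
    obtain ⟨k, n, h⟩ := ih
    rcases hx with rfl | ⟨i, rfl⟩
    · obtain ⟨m, hm⟩ := D.exists_inv_mul_latticeMap n
      refine ⟨k - 1, m, fun p => ?_⟩
      rw [hm]
      constructor
      · change ((D.α⁻¹ : ℝ) : ℂ) * ((y p).1 : ℂ) + ((-(D.α⁻¹ * 0) : ℝ) : ℂ) = _
        rw [(h p).1, zpow_sub_one₀ hα]; push_cast; ring
      · change D.β⁻¹ * (y p).2 + -(D.β⁻¹ * 0) = _
        rw [(h p).2, zpow_sub_one₀ D.β_ne_zero]; ring
    · refine ⟨k, n - Pi.single i 1, fun p => ?_⟩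
      have hs : D.latticeMap (fun j => ((n - Pi.single i 1 : Fin 3 → ℤ) j : ℝ)) =
          D.latticeMap (fun j => n j) - (D.a i, D.b i) := by
        have h1 : (fun j => ((n - Pi.single i 1 : Fin 3 → ℤ) j : ℝ)) =
            (fun j => (n j : ℝ)) - Pi.single i 1 := by
          funext j
          by_cases hj : j = i
          · subst hj; simp
          · simp [hj]
        rw [h1, map_sub]
        congr 1
        refine Prod.ext ?_ ?_ <;> simp [latticeMap, Pi.single_apply, apply_ite Complex.ofReal]
      rw [hs]
      constructor
      · change (((1 : ℝ)⁻¹ : ℝ) : ℂ) * ((y p).1 : ℂ) + ((-((1 : ℝ)⁻¹ * D.a i) : ℝ) : ℂ) = _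
        rw [(h p).1]; simp only [Prod.fst_sub]; push_cast; ring
      · change (1 : ℂ)⁻¹ * (y p).2 + -((1 : ℂ)⁻¹ * D.b i) = _
        rw [(h p).2]; simp; ring

theorem latticeMap_int_injective {n : Fin 3 → ℤ} (h : D.latticeMap (fun i => n i) = 0) :
    n = 0 := by
  have := (LinearMap.ker_eq_bot'.1 D.latticeMap_ker) _ h
  funext i
  have h := congrFun this i
  simpa using h

instance : IsCancelSMul D.deckGroup HalfPlaneProd := by
  rw [isCancelSMul_iff_eq_one_of_smul_eq]
  intro γ p hp
  obtain ⟨k, n, h⟩ := D.exists_normal_form γ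
  have h1 := (h p).1
  have h2 := (h p).2
  rw [hp] at h1 h2
  have hk : k = 0 := by
    have him := congrArg Complex.im h1
    rw [← Complex.ofReal_zpow, Complex.add_im, Complex.im_ofReal_mul, Complex.ofReal_im, add_zero,
      UpperHalfPlane.coe_im] at him
    have hpos := p.1.im_pos
    have : D.α ^ k = 1 := by
      have : (D.α ^ k - 1) * p.1.im = 0 := by linarith
      rcases mul_eq_zero.1 this with h | h
      · linarith
      · exact absurd h hpos.ne'
    exact (zpow_eq_one_iff_right₀ D.α_pos.le D.one_lt_α.ne').1 this
  subst hk
  have h0 : D.latticeMap (fun i => n i) = 0 := by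
    refine Prod.ext ?_ ?_
    · have : ((D.latticeMap (fun i => n i)).1 : ℂ) = 0 := by simpa using h1
      exact_mod_cast this
    · simpa using h2
  apply Subtype.ext
  apply Diffeomorph.ext
  intro q
  have hq := h q
  rw [h0] at hq
  change γ • q = q
  exact Prod.ext (UpperHalfPlane.ext (by simpa using hq.1)) (by simpa using hq.2)

instance : ProperlyDiscontinuousSMul D.deckGroup HalfPlaneProd where
  finite_disjoint_inter_image {K L} hK hL := by
    choose k n h using D.exists_normal_form
    have hinj : Function.Injective (fun γ => (k γ, n γ)) := by
      intro γ γ' e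
      obtain ⟨e1, e2⟩ := Prod.mk.inj e
      apply Subtype.ext
      apply Diffeomorph.ext
      intro q
      have hq := h γ q
      have hq' := h γ' q
      rw [e1, e2] at hq
      exact Prod.ext (UpperHalfPlane.ext (hq.1.trans hq'.1.symm)) (hq.2.trans hq'.2.symm)
    have hlog : 0 < Real.log D.α := Real.log_pos D.one_lt_α
    -- the possible exponents
    let ρ : HalfPlaneProd × HalfPlaneProd → ℝ :=
      fun x => Real.log (x.2.1.im / x.1.1.im) / Real.log D.α
    have hρ : Continuous ρ := by
      have h1 : Continuous fun x : HalfPlaneProd × HalfPlaneProd => x.1.1.im :=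
        UpperHalfPlane.continuous_im.comp (continuous_fst.comp continuous_fst)
      have h2 : Continuous fun x : HalfPlaneProd × HalfPlaneProd => x.2.1.im :=
        UpperHalfPlane.continuous_im.comp (continuous_fst.comp continuous_snd)
      refine Continuous.div_const (Continuous.log (h2.div h1 fun x => x.1.1.im_pos.ne') ?_) _
      exact fun x => (div_pos x.2.1.im_pos x.1.1.im_pos).ne'
    let KZ : Set ℤ := (Int.cast : ℤ → ℝ) ⁻¹' (ρ '' (K ×ˢ L))
    have hKZ : KZ.Finite :=
      (Int.isClosedEmbedding_coe_real.isCompact_preimage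
        ((hK.prod hL).image hρ)).finite_of_discrete
    -- the possible translations, for a given exponent
    let τ : ℤ → HalfPlaneProd × HalfPlaneProd → ℝ × ℂ := fun j x =>
      (x.2.1.re - D.α ^ j * x.1.1.re, x.2.2 - D.β ^ j * x.1.2)
    have hτ : ∀ j, Continuous (τ j) := by
      intro j
      have h1 : Continuous fun x : HalfPlaneProd × HalfPlaneProd => x.1.1.re :=
        UpperHalfPlane.continuous_re.comp (continuous_fst.comp continuous_fst)
      have h2 : Continuous fun x : HalfPlaneProd × HalfPlaneProd => x.2.1.re :=
        UpperHalfPlane.continuous_re.comp (continuous_fst.comp continuous_snd)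
      exact (h2.sub (continuous_const.mul h1)).prodMk
        ((continuous_snd.comp continuous_snd).sub
          (continuous_const.mul (continuous_snd.comp continuous_fst)))
    have hemb : Topology.IsClosedEmbedding
        (fun m : Fin 3 → ℤ => D.latticeMap (fun i => (m i : ℝ))) :=
      (LinearMap.isClosedEmbedding_of_injective D.latticeMap_ker).comp
        (Topology.IsClosedEmbedding.piMap fun _ : Fin 3 => Int.isClosedEmbedding_coe_real)
    let F : ℤ → Set (Fin 3 → ℤ) := fun j =>
      (fun m : Fin 3 → ℤ => D.latticeMap (fun i => (m i : ℝ))) ⁻¹' (τ j '' (K ×ˢ L))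
    have hF : ∀ j, (F j).Finite := fun j =>
      (hemb.isCompact_preimage ((hK.prod hL).image (hτ j))).finite_of_discrete
    have hfin : (⋃ j ∈ KZ, (fun m => (j, m)) '' F j).Finite :=
      hKZ.biUnion fun j _ => (hF j).image _
    refine (hfin.preimage hinj.injOn).subset ?_
    rintro γ ⟨q, ⟨p, hp, rfl⟩, hq⟩
    have hx : (p, γ • p) ∈ K ×ˢ L := ⟨hp, hq⟩
    have h1 := (h γ p).1
    have h2 := (h γ p).2
    rw [← Complex.ofReal_zpow] at h1
    have him := congrArg Complex.im h1
    have hre := congrArg Complex.re h1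
    rw [Complex.add_im, Complex.im_ofReal_mul, Complex.ofReal_im, add_zero,
      UpperHalfPlane.coe_im, UpperHalfPlane.coe_im] at him
    rw [Complex.add_re, Complex.re_ofReal_mul, Complex.ofReal_re,
      UpperHalfPlane.coe_re, UpperHalfPlane.coe_re] at hre
    refine Set.mem_biUnion (x := k γ) ⟨_, hx, ?_⟩ ⟨n γ, ⟨_, hx, ?_⟩, rfl⟩
    · simp only [ρ]
      rw [him, mul_div_assoc, div_self p.1.im_pos.ne', mul_one, Real.log_zpow,
        mul_div_assoc, div_self hlog.ne', mul_one]
    · refine Prod.ext ?_ ?_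
      · simp only [τ]; rw [hre]; ring
      · simp only [τ]; rw [h2]; ring

instance : ContinuousConstSMul D.deckGroup HalfPlaneProd where
  continuous_const_smul γ := Diffeomorph.continuous (γ : HolAut modelC2 HalfPlaneProd)

/-- The Inoue surface `X = (ℍ × ℂ) / G_M` of type `S_M`, with the quotient topology. -/
abbrev Surface : Type := MulAction.orbitRel.Quotient D.deckGroup HalfPlaneProd

/-- The quotient map `π : ℍ × ℂ → X`. -/
def proj (p : HalfPlaneProd) : D.Surface := Quotient.mk _ p

/-- The charts of `X` are the local inverses of the covering map `π : ℍ × ℂ → X`, followed by the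
inclusion `ℍ × ℂ ⊆ ℂ × ℂ`. -/
instance : ChartedSpace (ModelProd ℂ ℂ) D.Surface := MulAction.instChartedSpaceQuotient

/-- `X` is a complex manifold. -/
instance : IsManifold modelC2 ω D.Surface := by
  have hπ : IsLocalHomeomorph (Quotient.mk (MulAction.orbitRel D.deckGroup HalfPlaneProd)) :=
    isQuotientCoveringMap_quotientMk_of_properlyDiscontinuousSMul.isCoveringMap.isLocalHomeomorph
  have hsm : ∀ (γ : D.deckGroup) (p : HalfPlaneProd),
      (Quotient.mk (MulAction.orbitRel D.deckGroup HalfPlaneProd)) (γ • p) = Quotient.mk _ p :=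
    fun γ p => Quotient.sound ⟨γ, rfl⟩
  have key : ∀ p₀ p₁ : HalfPlaneProd,
      ContMDiffOn modelC2 modelC2 ω
        (((hπ.localInverseAt p₀).trans (chartAt (ModelProd ℂ ℂ) p₀)).symm.trans
          ((hπ.localInverseAt p₁).trans (chartAt (ModelProd ℂ ℂ) p₁)))
        (((hπ.localInverseAt p₀).trans (chartAt (ModelProd ℂ ℂ) p₀)).symm.trans
          ((hπ.localInverseAt p₁).trans (chartAt (ModelProd ℂ ℂ) p₁))).source := by
    intro p₀ p₁ h hh
    apply ContMDiffAt.contMDiffWithinAt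
    set s := hπ.localInverseAt p₀ with hs
    set s' := hπ.localInverseAt p₁ with hs'
    set c := chartAt (ModelProd ℂ ℂ) p₀ with hc
    set c' := chartAt (ModelProd ℂ ℂ) p₁ with hc'
    have hss : ∀ q, s.symm q = Quotient.mk _ q := fun q => by rw [hs, hπ.localInverseAt_symm]
    have hss' : ∀ q, s'.symm q = Quotient.mk _ q := fun q => by rw [hs', hπ.localInverseAt_symm]
    simp only [OpenPartialHomeomorph.trans_source, OpenPartialHomeomorph.symm_source,
      OpenPartialHomeomorph.trans_target, OpenPartialHomeomorph.coe_trans_symm,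
      Set.mem_inter_iff, Set.mem_preimage, Function.comp_apply] at hh
    obtain ⟨⟨hh1, hh2⟩, hh3, hh4⟩ := hh
    rw [hss] at hh3 hh4
    set p := c.symm h with hp
    have hrel : Quotient.mk (MulAction.orbitRel D.deckGroup HalfPlaneProd)
        (s' (Quotient.mk _ p)) = Quotient.mk _ p := by
      rw [← hss', s'.left_inv hh3]
    obtain ⟨γ, hγ⟩ : ∃ γ : D.deckGroup, γ • p = s' (Quotient.mk _ p) :=
      Quotient.exact hrel
    have hγs : ContMDiff modelC2 modelC2 ω (fun q : HalfPlaneProd => γ • q) :=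
      Diffeomorph.contMDiff (γ : HolAut modelC2 HalfPlaneProd)
    have hcs : ContMDiffAt modelC2 modelC2 ω c.symm h :=
      (contMDiffOn_chart_symm (I := modelC2) (x := p₀)).contMDiffAt
        (c.open_target.mem_nhds hh1)
    have hc's : ContMDiffAt modelC2 modelC2 ω c' (γ • p) := by
      rw [hγ]
      exact (contMDiffOn_chart (I := modelC2) (x := p₁)).contMDiffAt
        (c'.open_source.mem_nhds hh4)
    have hmain : ContMDiffAt modelC2 modelC2 ω (fun t => c' (γ • c.symm t)) h :=
      ContMDiffAt.comp h hc's (ContMDiffAt.comp h hγs.contMDiffAt hcs)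
    refine hmain.congr_of_eventuallyEq ?_
    have hev : ∀ᶠ t in nhds h, γ • c.symm t ∈ s'.target := by
      have hcont : ContinuousAt (fun t => γ • c.symm t) h :=
        (hγs.contMDiffAt.comp h hcs).continuousAt
      refine hcont.eventually (s'.open_target.mem_nhds ?_)
      change γ • p ∈ s'.target
      rw [hγ]
      exact s'.map_source hh3
    filter_upwards [hev] with t ht
    change c' (s' (s.symm (c.symm t))) = c' (γ • c.symm t)
    rw [hss, ← hsm γ, ← hss', s'.right_inv ht]
  refine isManifold_of_contDiffOn modelC2 ω D.Surface ?_
  have chart : ∀ e e' : OpenPartialHomeomorph D.Surface (ModelProd ℂ ℂ),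
      ContMDiffOn modelC2 modelC2 ω (e.symm.trans e') (e.symm.trans e').source →
      ContDiffOn ℂ ω (modelC2 ∘ (e.symm.trans e') ∘ modelC2.symm)
        (modelC2.symm ⁻¹' (e.symm.trans e').source ∩ Set.range modelC2) := by
    intro e e' he
    let y : ModelProd ℂ ℂ := ((0 : ℂ), (0 : ℂ))
    have h := (contMDiffOn_iff.1 he).2 y y
    have h1 : chartAt (ModelProd ℂ ℂ) y = OpenPartialHomeomorph.refl _ :=
      chartAt_self_eq
    have h2 : extChartAt modelC2 y = modelC2.toPartialEquiv := by
      rw [extChartAt, h1]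
      simp only [mfld_simps]
    rw [h2] at h
    refine h.mono ?_
    rintro x ⟨hx, hx'⟩
    refine ⟨?_, hx, ?_⟩
    · simp only [mfld_simps]
    · simp only [mfld_simps]
  rintro e e' ⟨q₀, rfl⟩ ⟨q₁, rfl⟩
  exact chart _ _ (key _ _)

/-- The group `Aut(X)` of biholomorphic self-maps of the Inoue surface `X`. -/
abbrev Aut : Type := HolAut modelC2 D.Surface

/-- An automorphism `u` of `ℍ × ℂ` is a lift of the automorphism `f` of `X` if `π ∘ u = f ∘ π`. -/
def IsLift (u : HolAut modelC2 HalfPlaneProd) (f : D.Aut) : Prop :=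
  ∀ p, D.proj (u p) = f (D.proj p)

end InoueSMData

end

open scoped commutatorElement

noncomputable section

/-! Since `ℍ × ℂ` is simply connected, it is the universal cover of `X`. So automorphisms of `X`
lift, and by uniqueness of lifts `G_M` is the full group of deck transformations; hence the lifts
are exactly the normaliser of `G_M`. It remains to see that the normaliser consists of affine maps
with diagonal linear part (`mem_affineSubgroup_of_mem_normalizer`).

Let `u` normalise `G_M`. Commutators of affine maps with diagonal linear part are translations. The
commutators of `g₀` with the lattice translations are translations by a lattice of rank 3 in `ℝ ×
ℂ`, and conjugation by `u` turns them into commutators in `G_M`, again translations. So `u` is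
additive along this lattice up to constants, and its derivative is periodic (`exists_eq_clm_add`).

A periodic holomorphic function is constant (`periodic_apply_eq_apply`): on a slice `Im w = const`
it is determined on a compact set, so by Liouville it does not depend on `z`; in `w` it then has
arbitrarily small real periods, since the first coordinates of the lattice are stable under `α⁻¹`.
Hence `u` is affine. Bijectivity on `ℍ × ℂ` restricts its coefficients, and normalisation of `g₀`
with `α ≠ β` removes the remaining off-diagonal entry.

Such affine maps form a metabelian group, and commutators of lifts lift commutators, so the second
derived subgroup of `Aut(X)` is trivial (`derivedSeries_aut_two`). -/

theorem HolAut.mul_apply {E H : Type*} [NormedAddCommGroup E] [NormedSpace ℂ E]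
    [TopologicalSpace H] {I : ModelWithCorners ℂ E H} {X : Type*} [TopologicalSpace X]
    [ChartedSpace H X] (f g : HolAut I X) (x : X) : (f * g) x = f (g x) := rfl

theorem HolAut.inv_apply_self {E H : Type*} [NormedAddCommGroup E] [NormedSpace ℂ E]
    [TopologicalSpace H] {I : ModelWithCorners ℂ E H} {X : Type*} [TopologicalSpace X]
    [ChartedSpace H X] (f : HolAut I X) (x : X) : f⁻¹ (f x) = x := f.symm_apply_apply x

theorem HolAut.apply_inv_self {E H : Type*} [NormedAddCommGroup E] [NormedSpace ℂ E]
    [TopologicalSpace H] {I : ModelWithCorners ℂ E H} {X : Type*} [TopologicalSpace X]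
    [ChartedSpace H X] (f : HolAut I X) (x : X) : f (f⁻¹ x) = x := f.apply_symm_apply x

/-! ### Affine automorphisms, translations and their commutators -/

theorem affineAut_mul (a : ℝ) (ha : 0 < a) (b : ℝ) (A : ℂ) (hA : A ≠ 0) (B : ℂ)
    (a' : ℝ) (ha' : 0 < a') (b' : ℝ) (A' : ℂ) (hA' : A' ≠ 0) (B' : ℂ) :
    affineAut a ha b A hA B * affineAut a' ha' b' A' hA' B' =
      affineAut (a * a') (mul_pos ha ha') (a * b' + b) (A * A') (mul_ne_zero hA hA')
        (A * B' + B) := by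
  refine Diffeomorph.ext fun p => ?_
  rw [HolAut.mul_apply, affineAut_apply, affineAut_apply, affineAut_apply]
  refine Prod.ext (UpperHalfPlane.ext ?_) ?_
  · simp only [coe_halfPlaneAffine]; push_cast; ring
  · simp only; ring

theorem affineAut_one : affineAut 1 one_pos 0 1 one_ne_zero 0 = 1 := by
  refine Diffeomorph.ext fun p => ?_
  rw [affineAut_apply]
  change _ = p
  refine Prod.ext (UpperHalfPlane.ext ?_) ?_ <;> simp [coe_halfPlaneAffine]

theorem affineAut_congr {a a' : ℝ} {ha : 0 < a} {ha' : 0 < a'} {b b' : ℝ} {A A' : ℂ}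
    {hA : A ≠ 0} {hA' : A' ≠ 0} {B B' : ℂ} (h1 : a = a') (h2 : b = b') (h3 : A = A')
    (h4 : B = B') : affineAut a ha b A hA B = affineAut a' ha' b' A' hA' B' := by
  subst h1 h2 h3 h4; rfl

theorem affineAut_inv (a : ℝ) (ha : 0 < a) (b : ℝ) (A : ℂ) (hA : A ≠ 0) (B : ℂ) :
    (affineAut a ha b A hA B)⁻¹ =
      affineAut a⁻¹ (inv_pos.2 ha) (-(a⁻¹ * b)) A⁻¹ (inv_ne_zero hA) (-(A⁻¹ * B)) := by
  rw [inv_eq_iff_mul_eq_one, affineAut_mul, ← affineAut_one]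
  exact affineAut_congr (mul_inv_cancel₀ ha.ne') (by field_simp; ring) (mul_inv_cancel₀ hA)
    (by field_simp; ring)

/-- The group of the automorphisms `(w, z) ↦ (a w + b, A z + B)` of `ℍ × ℂ`. -/
def affineSubgroup : Subgroup (HolAut modelC2 HalfPlaneProd) where
  carrier := {u | ∃ (a : ℝ) (ha : 0 < a) (b : ℝ) (A : ℂ) (hA : A ≠ 0) (B : ℂ),
    u = affineAut a ha b A hA B}
  one_mem' := ⟨1, one_pos, 0, 1, one_ne_zero, 0, affineAut_one.symm⟩
  mul_mem' := by
    rintro _ _ ⟨a, ha, b, A, hA, B, rfl⟩ ⟨a', ha', b', A', hA', B', rfl⟩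
    exact ⟨_, _, _, _, _, _, affineAut_mul ..⟩
  inv_mem' := by
    rintro _ ⟨a, ha, b, A, hA, B, rfl⟩
    exact ⟨_, _, _, _, _, _, affineAut_inv ..⟩

/-- The translation `(w, z) ↦ (w + b, z + B)` of `ℍ × ℂ`. -/
def translationAut (b : ℝ) (B : ℂ) : HolAut modelC2 HalfPlaneProd :=
  affineAut 1 one_pos b 1 one_ne_zero B

theorem coe_translationAut_fst (b : ℝ) (B : ℂ) (p : HalfPlaneProd) :
    ((translationAut b B p).1 : ℂ) = p.1 + b := by
  rw [translationAut, affineAut_apply, coe_halfPlaneAffine]; simp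

theorem translationAut_snd (b : ℝ) (B : ℂ) (p : HalfPlaneProd) :
    (translationAut b B p).2 = p.2 + B := by
  rw [translationAut, affineAut_apply]; simp

theorem translationAut_mul (b : ℝ) (B : ℂ) (b' : ℝ) (B' : ℂ) :
    translationAut b B * translationAut b' B' = translationAut (b + b') (B + B') := by
  rw [translationAut, translationAut, affineAut_mul]
  exact affineAut_congr (by simp) (by ring) (by simp) (by ring)

theorem translationAut_inv (b : ℝ) (B : ℂ) :
    (translationAut b B)⁻¹ = translationAut (-b) (-B) := by
  rw [translationAut, affineAut_inv]
  exact affineAut_congr (by simp) (by simp) (by simp) (by simp)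

/-- The group of translations of `ℍ × ℂ`. -/
def translationSubgroup : Subgroup (HolAut modelC2 HalfPlaneProd) where
  carrier := {u | ∃ (b : ℝ) (B : ℂ), u = translationAut b B}
  one_mem' := ⟨0, 0, affineAut_one.symm⟩
  mul_mem' := by
    rintro _ _ ⟨b, B, rfl⟩ ⟨b', B', rfl⟩
    exact ⟨_, _, translationAut_mul ..⟩
  inv_mem' := by
    rintro _ ⟨b, B, rfl⟩
    exact ⟨_, _, translationAut_inv ..⟩

/-- The linear parts are diagonal and cancel, so only a translation survives. -/
theorem commutatorElement_affineAut (a : ℝ) (ha : 0 < a) (b : ℝ) (A : ℂ) (hA : A ≠ 0) (B : ℂ)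
    (a' : ℝ) (ha' : 0 < a') (b' : ℝ) (A' : ℂ) (hA' : A' ≠ 0) (B' : ℂ) :
    ⁅affineAut a ha b A hA B, affineAut a' ha' b' A' hA' B'⁆ =
      translationAut ((a - 1) * b' - (a' - 1) * b) ((A - 1) * B' - (A' - 1) * B) := by
  rw [commutatorElement_def, mul_inv_eq_iff_eq_mul, mul_inv_eq_iff_eq_mul, translationAut]
  simp only [affineAut_mul]
  exact affineAut_congr (by ring) (by ring) (by ring) (by ring)

theorem commutatorElement_mem_translationSubgroup {u v : HolAut modelC2 HalfPlaneProd}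
    (hu : u ∈ affineSubgroup) (hv : v ∈ affineSubgroup) : ⁅u, v⁆ ∈ translationSubgroup := by
  obtain ⟨a, ha, b, A, hA, B, rfl⟩ := hu
  obtain ⟨a', ha', b', A', hA', B', rfl⟩ := hv
  exact ⟨_, _, commutatorElement_affineAut ..⟩

theorem commutatorElement_eq_one_of_mem_translationSubgroup
    {u v : HolAut modelC2 HalfPlaneProd}
    (hu : u ∈ translationSubgroup) (hv : v ∈ translationSubgroup) : ⁅u, v⁆ = 1 := by
  obtain ⟨b, B, rfl⟩ := hu
  obtain ⟨b', B', rfl⟩ := hv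
  rw [commutatorElement_eq_one_iff_mul_comm, translationAut_mul, translationAut_mul, add_comm b,
    add_comm B]

namespace InoueSMData

variable (D : InoueSMData)

theorem deckGroup_le_affineSubgroup : D.deckGroup ≤ affineSubgroup := by
  refine (Subgroup.closure_le _).2 ?_
  rintro _ (rfl | ⟨i, rfl⟩)
  · exact ⟨_, _, _, _, _, _, rfl⟩
  · exact ⟨_, _, _, _, _, _, rfl⟩

theorem g₀_mem_deckGroup : D.g₀ ∈ D.deckGroup :=
  Subgroup.subset_closure (Set.mem_insert _ _)

/-- The vectors whose translation lies in `G_M` form an additive group containing every `(aᵢ, bᵢ)`.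
-/
theorem translationAut_latticeMap_mem_deckGroup (n : Fin 3 → ℤ) :
    translationAut (D.latticeMap (fun i => n i)).1 (D.latticeMap (fun i => n i)).2 ∈
      D.deckGroup := by
  let S : AddSubgroup (ℝ × ℂ) :=
    { carrier := {q : ℝ × ℂ | translationAut q.1 q.2 ∈ D.deckGroup}
      zero_mem' := by
        rw [Set.mem_ofPred_eq, Prod.fst_zero, Prod.snd_zero, translationAut, affineAut_one]
        exact one_mem _
      add_mem' := by
        intro q q' hq hq'
        rw [Set.mem_ofPred_eq, Prod.fst_add, Prod.snd_add, ← translationAut_mul]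
        exact mul_mem hq hq'
      neg_mem' := by
        intro q hq
        rw [Set.mem_ofPred_eq, Prod.fst_neg, Prod.snd_neg, ← translationAut_inv]
        exact inv_mem hq }
  have h : D.latticeMap (fun i => n i) = ∑ i, n i • (D.a i, D.b i) := by
    refine Prod.ext ?_ ?_ <;> simp [latticeMap, Prod.fst_sum, Prod.snd_sum]
  have hS : ∀ i, (D.a i, D.b i) ∈ S := fun i =>
    Subgroup.subset_closure (Set.mem_insert_of_mem _ ⟨i, rfl⟩)
  have h' : D.latticeMap (fun i => n i) ∈ S := by
    rw [h]
    exact sum_mem fun i _ => zsmul_mem (hS i) _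
  exact h'

end InoueSMData

/-! ### The covering `π`, lifts and the normaliser of `G_M` -/

namespace InoueSMData

variable (D : InoueSMData)

theorem isCoveringMap_proj : IsCoveringMap D.proj :=
  isQuotientCoveringMap_quotientMk_of_properlyDiscontinuousSMul.isCoveringMap

theorem continuous_proj : Continuous D.proj := D.isCoveringMap_proj.continuous

theorem proj_surjective : Function.Surjective D.proj := Quotient.mk_surjective

theorem proj_eq_proj_iff {p q : HalfPlaneProd} :
    D.proj p = D.proj q ↔ ∃ γ ∈ D.deckGroup, γ q = p := by
  refine (Quotient.eq (r := MulAction.orbitRel D.deckGroup HalfPlaneProd)).trans ?_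
  constructor
  · rintro ⟨γ, hγ⟩
    exact ⟨γ, γ.2, hγ⟩
  · rintro ⟨γ, hγ, h⟩
    exact ⟨⟨γ, hγ⟩, h⟩

theorem proj_apply_of_mem {γ : HolAut modelC2 HalfPlaneProd} (hγ : γ ∈ D.deckGroup)
    (p : HalfPlaneProd) : D.proj (γ p) = D.proj p :=
  D.proj_eq_proj_iff.2 ⟨γ, hγ, rfl⟩

/-- The chart of `X` at the class of `p` is a local inverse of `π` followed by a chart. -/
theorem exists_localInverse_chartAt (p : HalfPlaneProd) :
    ∃ (γ : HolAut modelC2 HalfPlaneProd) (s : OpenPartialHomeomorph D.Surface HalfPlaneProd),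
      γ ∈ D.deckGroup ∧ γ p ∈ s.target ∧ (∀ q, s.symm q = D.proj q) ∧
      chartAt (ModelProd ℂ ℂ) (D.proj p) = s.trans (chartAt (ModelProd ℂ ℂ) (γ p)) := by
  have hπ : IsLocalHomeomorph D.proj := D.isCoveringMap_proj.isLocalHomeomorph
  -- The atlas of `X` chooses a preimage of each point; it need not be `p`, only a deck translate `γ
  -- p`.
  obtain ⟨p₀, hp₀, hc⟩ : ∃ p₀, D.proj p₀ = D.proj p ∧ chartAt (ModelProd ℂ ℂ) (D.proj p) =
      (hπ.localInverseAt p₀).trans (chartAt (ModelProd ℂ ℂ) p₀) :=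
    ⟨_, D.proj_surjective.hasRightInverse.choose_spec (D.proj p), rfl⟩
  obtain ⟨γ, hγ, rfl⟩ := D.proj_eq_proj_iff.1 hp₀
  exact ⟨γ, hπ.localInverseAt (γ p), hγ, hπ.self_mem_localInverseAt_target,
    fun q => by rw [hπ.localInverseAt_symm], hc⟩

/-- Holomorphic local sections of `π` transfer holomorphy between `X` and `ℍ × ℂ`. Composing the
chart's local inverse with `γ⁻¹` moves its value from `γ p` back to `p`. -/
theorem exists_localSection (p : HalfPlaneProd) :
    ∃ σ : D.Surface → HalfPlaneProd, ContMDiffAt modelC2 modelC2 ω σ (D.proj p) ∧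
      σ (D.proj p) = p ∧ (∀ᶠ y in nhds (D.proj p), D.proj (σ y) = y) ∧
      ∀ᶠ q in nhds p, σ (D.proj q) = q := by
  obtain ⟨γ, s, hγ, hs, hsymm, hc⟩ := D.exists_localInverse_chartAt p
  have hinv : ∀ q, γ q ∈ s.target → s (D.proj q) = γ q := fun q hq => by
    rw [← D.proj_apply_of_mem hγ, ← hsymm, s.right_inv hq]
  have hx : D.proj p ∈ s.source := by
    rw [← D.proj_apply_of_mem hγ, ← hsymm]
    exact s.map_target hs
  -- The chart of `X` is `s` followed by a chart of `ℍ × ℂ`; undoing the latter recovers `s`.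
  have hs' : ContMDiffAt modelC2 modelC2 ω s (D.proj p) := by
    have h1 : ContMDiffAt modelC2 modelC2 ω (chartAt (ModelProd ℂ ℂ) (D.proj p)) (D.proj p) :=
      (contMDiffOn_chart (I := modelC2) (x := D.proj p)).contMDiffAt
        ((chartAt (ModelProd ℂ ℂ) (D.proj p)).open_source.mem_nhds (mem_chart_source _ _))
    have h2 : ContMDiffAt modelC2 modelC2 ω (chartAt (ModelProd ℂ ℂ) (γ p)).symm
        (chartAt (ModelProd ℂ ℂ) (D.proj p) (D.proj p)) := by
      refine (contMDiffOn_chart_symm (I := modelC2) (x := γ p)).contMDiffAt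
        ((chartAt (ModelProd ℂ ℂ) (γ p)).open_target.mem_nhds ?_)
      rw [hc, OpenPartialHomeomorph.coe_trans, Function.comp_apply, hinv p hs]
      exact mem_chart_target _ _
    refine (ContMDiffAt.comp _ h2 h1).congr_of_eventuallyEq ?_
    filter_upwards [(chartAt (ModelProd ℂ ℂ) (D.proj p)).open_source.mem_nhds
      (mem_chart_source _ (D.proj p))] with y hy
    rw [hc] at hy ⊢
    rw [Function.comp_apply, OpenPartialHomeomorph.coe_trans, Function.comp_apply,
      OpenPartialHomeomorph.left_inv _ (by simpa using hy.2)]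
  refine ⟨fun y => γ⁻¹ (s y), ?_, ?_, ?_, ?_⟩
  · exact ((γ⁻¹ : HolAut modelC2 HalfPlaneProd).contMDiff.contMDiffAt).comp _ hs'
  · change γ⁻¹ (s (D.proj p)) = p
    rw [hinv p hs, HolAut.inv_apply_self]
  · filter_upwards [s.open_source.mem_nhds hx] with y hy
    rw [D.proj_apply_of_mem (inv_mem hγ), ← hsymm, s.left_inv hy]
  · filter_upwards [γ.continuous.continuousAt.eventually (s.open_target.mem_nhds hs)] with q hq
    rw [hinv q hq, HolAut.inv_apply_self]

theorem contMDiff_proj : ContMDiff modelC2 modelC2 ω D.proj := by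
  intro p
  obtain ⟨γ, s, hγ, hs, hsymm, hc⟩ := D.exists_localInverse_chartAt p
  have h1 : ContMDiffAt modelC2 modelC2 ω (fun q => chartAt (ModelProd ℂ ℂ) (γ p) (γ q)) p :=
    ContMDiffAt.comp p ((contMDiffOn_chart (I := modelC2) (x := γ p)).contMDiffAt
        ((chartAt (ModelProd ℂ ℂ) (γ p)).open_source.mem_nhds (mem_chart_source _ _)))
      γ.contMDiff.contMDiffAt
  have hinv : ∀ q, γ q ∈ s.target → s (D.proj q) = γ q := fun q hq => by
    rw [← D.proj_apply_of_mem hγ, ← hsymm, s.right_inv hq]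
  have h2 : ContMDiffAt modelC2 modelC2 ω (chartAt (ModelProd ℂ ℂ) (D.proj p)).symm
      (chartAt (ModelProd ℂ ℂ) (γ p) (γ p)) := by
    have := (contMDiffOn_chart_symm (I := modelC2) (n := ω) (x := D.proj p)).contMDiffAt
      ((chartAt (ModelProd ℂ ℂ) (D.proj p)).open_target.mem_nhds (mem_chart_target _ (D.proj p)))
    rwa [hc, OpenPartialHomeomorph.coe_trans, Function.comp_apply, hinv p hs, ← hc] at this
  refine (ContMDiffAt.comp p h2 h1).congr_of_eventuallyEq ?_
  filter_upwards [γ.continuous.continuousAt.eventually (s.open_target.mem_nhds hs),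
    γ.continuous.continuousAt.eventually
      ((chartAt (ModelProd ℂ ℂ) (γ p)).open_source.mem_nhds (mem_chart_source _ _))] with q hq hq'
  rw [Function.comp_apply, hc, OpenPartialHomeomorph.coe_trans_symm, Function.comp_apply,
    OpenPartialHomeomorph.left_inv _ hq', hsymm, D.proj_apply_of_mem hγ]

theorem contMDiff_of_comp_proj {f : D.Surface → D.Surface}
    (hf : ContMDiff modelC2 modelC2 ω (f ∘ D.proj)) : ContMDiff modelC2 modelC2 ω f := by
  intro x
  obtain ⟨p, rfl⟩ := D.proj_surjective x
  obtain ⟨σ, hσ, hp, h1, -⟩ := D.exists_localSection p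
  refine (ContMDiffAt.comp _ hf.contMDiffAt hσ).congr_of_eventuallyEq ?_
  filter_upwards [h1] with y hy
  simp [hy]

theorem contMDiff_of_proj_comp {u : HalfPlaneProd → HalfPlaneProd} (hu : Continuous u)
    (h : ContMDiff modelC2 modelC2 ω (D.proj ∘ u)) : ContMDiff modelC2 modelC2 ω u := by
  intro p
  obtain ⟨σ, hσ, hp, -, h1⟩ := D.exists_localSection (u p)
  refine (ContMDiffAt.comp (g := σ) p hσ h.contMDiffAt).congr_of_eventuallyEq ?_
  filter_upwards [hu.continuousAt.eventually h1] with y hy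
  simp [hy]

instance : LocallyPathConnectedSpace ℍ :=
  UpperHalfPlane.isOpenEmbedding_coe.locallyPathConnectedSpace

/-- The source of `f ∘ π` is simply connected and locally path connected, so a continuous lift
exists; it is holomorphic because locally it is a section of `π` after `f ∘ π`. -/
theorem exists_continuous_lift (f : D.Aut) (p q : HalfPlaneProd)
    (h : D.proj q = f (D.proj p)) :
    ∃ u : HalfPlaneProd → HalfPlaneProd, ContMDiff modelC2 modelC2 ω u ∧ u p = q ∧
      ∀ x, D.proj (u x) = f (D.proj x) := by
  obtain ⟨u, ⟨hup, hu⟩, -⟩ := D.isCoveringMap_proj.existsUnique_continuousMap_lifts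
    ⟨f ∘ D.proj, f.continuous.comp D.continuous_proj⟩ p q h
  refine ⟨u, D.contMDiff_of_proj_comp u.continuous ?_, hup, congrFun hu⟩
  rw [hu]
  exact f.contMDiff.comp D.contMDiff_proj

theorem eq_id_of_proj_comp {v : HalfPlaneProd → HalfPlaneProd} (hv : Continuous v)
    (h : ∀ p, D.proj (v p) = D.proj p) {p : HalfPlaneProd} (hp : v p = p) : v = id :=
  D.isCoveringMap_proj.eq_of_comp_eq hv continuous_id (funext h) p hp

theorem exists_isLift (f : D.Aut) : ∃ u : HolAut modelC2 HalfPlaneProd, D.IsLift u f := by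
  let p : HalfPlaneProd := (UpperHalfPlane.I, 0)
  obtain ⟨q, hq⟩ := D.proj_surjective (f (D.proj p))
  obtain ⟨u, hu, hup, hlu⟩ := D.exists_continuous_lift f p q hq
  -- With matching base points, both composites of `u` and `v` lift the identity and fix a point.
  obtain ⟨v, hv, hvq, hlv⟩ := D.exists_continuous_lift f⁻¹ q p
    (by rw [hq, HolAut.inv_apply_self])
  have h1 : v ∘ u = id := D.eq_id_of_proj_comp (hv.continuous.comp hu.continuous)
    (fun x => by rw [Function.comp_apply, hlv, hlu, HolAut.inv_apply_self])
    (show v (u p) = p by rw [hup, hvq])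
  have h2 : u ∘ v = id := D.eq_id_of_proj_comp (hu.continuous.comp hv.continuous)
    (fun x => by rw [Function.comp_apply, hlu, hlv, HolAut.apply_inv_self])
    (show u (v q) = q by rw [hvq, hup])
  exact ⟨⟨⟨u, v, congrFun h1, congrFun h2⟩, hu, hv⟩, hlu⟩

/-- At one point `v` agrees with some `γ ∈ G_M`; then `γ⁻¹ v` lifts the identity and has a fixed
point. -/
theorem mem_deckGroup_iff {v : HolAut modelC2 HalfPlaneProd} :
    v ∈ D.deckGroup ↔ ∀ p, D.proj (v p) = D.proj p := by
  refine ⟨fun h => D.proj_apply_of_mem h, fun h => ?_⟩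
  let p : HalfPlaneProd := (UpperHalfPlane.I, 0)
  obtain ⟨γ, hγ, hp⟩ := D.proj_eq_proj_iff.1 (h p)
  have h1 : ⇑(γ⁻¹ * v) = id := D.eq_id_of_proj_comp (γ⁻¹ * v).continuous
    (fun x => by rw [HolAut.mul_apply, D.proj_apply_of_mem (inv_mem hγ), h])
    (p := p) (by rw [HolAut.mul_apply, ← hp, HolAut.inv_apply_self])
  have h2 : γ⁻¹ * v = 1 := Diffeomorph.ext (congrFun h1)
  rwa [← inv_mul_eq_one.1 h2]

variable {D}

theorem IsLift.mul {u v : HolAut modelC2 HalfPlaneProd} {f g : D.Aut} (hu : D.IsLift u f)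
    (hv : D.IsLift v g) : D.IsLift (u * v) (f * g) := fun p => by
  rw [HolAut.mul_apply, HolAut.mul_apply, hu, hv]

theorem IsLift.inv {u : HolAut modelC2 HalfPlaneProd} {f : D.Aut} (hu : D.IsLift u f) :
    D.IsLift u⁻¹ f⁻¹ := fun p => by
  conv_rhs => rw [← HolAut.apply_inv_self u p, hu, HolAut.inv_apply_self]

theorem IsLift.eq_one {f : D.Aut} (h : D.IsLift 1 f) : f = 1 := by
  refine Diffeomorph.ext fun x => ?_
  obtain ⟨p, rfl⟩ := D.proj_surjective x
  exact (h p).symm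

theorem IsLift.mem_normalizer {u : HolAut modelC2 HalfPlaneProd} {f : D.Aut}
    (hu : D.IsLift u f) :
    u ∈ Subgroup.normalizer (D.deckGroup : Set (HolAut modelC2 HalfPlaneProd)) := by
  -- Kept general in `u` and `f`: the converse inclusion applies it to `u⁻¹` and `f⁻¹`.
  have key : ∀ {u : HolAut modelC2 HalfPlaneProd} {f : D.Aut}, D.IsLift u f →
      ∀ γ ∈ D.deckGroup, u * γ * u⁻¹ ∈ D.deckGroup := by
    intro u f hu γ hγ
    refine D.mem_deckGroup_iff.2 fun p => ?_
    rw [HolAut.mul_apply, HolAut.mul_apply, hu, D.proj_apply_of_mem hγ, hu.inv,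
      HolAut.apply_inv_self]
  refine Subgroup.mem_normalizer_iff.2 fun γ => ⟨key hu γ, fun h => ?_⟩
  simpa [mul_assoc] using key hu.inv _ h

/-- A normalising `u` permutes the `G_M`-orbits. The maps induced by `u` and `u⁻¹` will be mutually
inverse. -/
theorem exists_comp_proj_eq {u : HolAut modelC2 HalfPlaneProd}
    (hu : u ∈ Subgroup.normalizer (D.deckGroup : Set (HolAut modelC2 HalfPlaneProd))) :
    ∃ f : D.Surface → D.Surface, ContMDiff modelC2 modelC2 ω f ∧
      ∀ p, D.proj (u p) = f (D.proj p) := by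
  have h : ∀ p q : HalfPlaneProd, MulAction.orbitRel D.deckGroup HalfPlaneProd p q →
      D.proj (u p) = D.proj (u q) := by
    rintro p q ⟨γ, hγ⟩
    refine D.proj_eq_proj_iff.2 ⟨_, (Subgroup.mem_normalizer_iff.1 hu γ).1 γ.2, ?_⟩
    rw [HolAut.mul_apply, HolAut.mul_apply, HolAut.inv_apply_self]
    exact congrArg u hγ
  exact ⟨Quotient.lift (fun p => D.proj (u p)) h,
    D.contMDiff_of_comp_proj (D.contMDiff_proj.comp u.contMDiff), fun p => rfl⟩

theorem exists_isLift_of_mem_normalizer {u : HolAut modelC2 HalfPlaneProd}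
    (hu : u ∈ Subgroup.normalizer (D.deckGroup : Set (HolAut modelC2 HalfPlaneProd))) :
    ∃ f : D.Aut, D.IsLift u f := by
  obtain ⟨f, hf, hfu⟩ := exists_comp_proj_eq hu
  obtain ⟨g, hg, hgu⟩ := exists_comp_proj_eq (inv_mem hu)
  refine ⟨⟨⟨f, g, fun x => ?_, fun x => ?_⟩, hf, hg⟩, hfu⟩
  · obtain ⟨p, rfl⟩ := D.proj_surjective x
    rw [← hfu, ← hgu, HolAut.inv_apply_self]
  · obtain ⟨p, rfl⟩ := D.proj_surjective x
    rw [← hgu, ← hfu, HolAut.apply_inv_self]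

end InoueSMData

/-! ### Holomorphic functions periodic under the commutator lattice -/

/-- The open set of `ℂ × ℂ` that corresponds to `ℍ × ℂ`. -/
def halfPlaneProdSet : Set (ℂ × ℂ) := {q | 0 < q.1.im}

theorem isOpen_halfPlaneProdSet : IsOpen halfPlaneProdSet :=
  isOpen_lt continuous_const (Complex.continuous_im.comp continuous_fst)

theorem isPreconnected_halfPlaneProdSet : IsPreconnected halfPlaneProdSet := by
  have h : halfPlaneProdSet = {w : ℂ | 0 < w.im} ×ˢ Set.univ := by
    ext q; simp [halfPlaneProdSet]
  rw [h]
  exact ((convex_halfSpace_im_gt 0).prod convex_univ).isPreconnected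

namespace InoueSMData

variable (D : InoueSMData)

theorem latticeMap_surjective : Function.Surjective D.latticeMap := by
  refine (LinearMap.injective_iff_surjective_of_finrank_eq_finrank ?_).1
    (LinearMap.ker_eq_bot.1 D.latticeMap_ker)
  simp [Module.finrank_prod]

theorem α_sub_one_ne_zero : D.α - 1 ≠ 0 := sub_ne_zero.2 D.one_lt_α.ne'

theorem β_sub_one_ne_zero : D.β - 1 ≠ 0 :=
  sub_ne_zero.2 fun h => D.β_ne_conj (by simp [h])

/-- The image in `ℂ × ℂ` of `(α - 1, β - 1) · (∑ xᵢ aᵢ, ∑ xᵢ bᵢ)`. For integral `x`, the translation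
by this vector is the commutator of `g₀` with the translation by `(∑ xᵢ aᵢ, ∑ xᵢ bᵢ)`. -/
def commutatorPeriod (x : Fin 3 → ℝ) : ℂ × ℂ :=
  ((((D.α - 1) * (D.latticeMap x).1 : ℝ) : ℂ), (D.β - 1) * (D.latticeMap x).2)

theorem commutatorPeriod_add (x y : Fin 3 → ℝ) :
    D.commutatorPeriod (x + y) = D.commutatorPeriod x + D.commutatorPeriod y := by
  refine Prod.ext ?_ ?_ <;> simp [commutatorPeriod, mul_add]

theorem continuous_commutatorPeriod : Continuous D.commutatorPeriod := by
  have h : Continuous D.latticeMap := D.latticeMap.continuous_of_finiteDimensional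
  exact (Complex.continuous_ofReal.comp (continuous_const.mul (continuous_fst.comp h))).prodMk
    (continuous_const.mul (continuous_snd.comp h))

/-- As `α` and `β` differ from 1, rescaling keeps the lattice of full rank in `ℝ × ℂ`. -/
theorem exists_commutatorPeriod_eq (x : ℝ) (z : ℂ) :
    ∃ t, D.commutatorPeriod t = ((x : ℂ), z) := by
  obtain ⟨t, ht⟩ := D.latticeMap_surjective (x / (D.α - 1), z / (D.β - 1))
  refine ⟨t, ?_⟩
  rw [commutatorPeriod, ht, mul_div_cancel₀ _ D.α_sub_one_ne_zero,
    mul_div_cancel₀ _ D.β_sub_one_ne_zero]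

theorem commutatorPeriod_add_mem_halfPlaneProdSet {q : ℂ × ℂ} (hq : q ∈ halfPlaneProdSet)
    (x : Fin 3 → ℝ) : q + D.commutatorPeriod x ∈ halfPlaneProdSet := by
  simpa [halfPlaneProdSet, commutatorPeriod] using hq

/-- `M⁻¹` is integral, so the first coordinates of the lattice are stable under `α⁻¹ < 1`. This is
the source of arbitrarily small periods. -/
theorem exists_latticeMap_fst_eq :
    ∃ c : ℝ, c ≠ 0 ∧ ∀ k : ℕ, ∃ n : Fin 3 → ℤ,
      (D.latticeMap (fun i => n i)).1 = (D.α⁻¹) ^ k * c := by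
  obtain ⟨i, hi⟩ := Function.ne_iff.1 D.a_ne_zero
  refine ⟨D.a i, hi, fun k => ?_⟩
  induction k with
  | zero =>
    refine ⟨Pi.single i 1, ?_⟩
    simp [latticeMap, Pi.single_apply]
  | succ k ih =>
    obtain ⟨n, hn⟩ := ih
    obtain ⟨m, hm⟩ := D.exists_inv_mul_latticeMap n
    exact ⟨m, by rw [hm, hn]; ring⟩

section Periodic

variable {D} {E : Type*} [NormedAddCommGroup E] [NormedSpace ℂ E]
  {F : ℂ × ℂ → E}

/-- The slice of fixed `Im w` is a copy of `ℝ × ℂ`, on which the lattice acts cocompactly. So `F` is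
bounded there, and Liouville applies to the entire function `z ↦ F (w, z)`. -/
theorem periodic_apply_eq_apply_zero (hF : DifferentiableOn ℂ F halfPlaneProdSet)
    (hper : ∀ (n : Fin 3 → ℤ), ∀ q ∈ halfPlaneProdSet,
      F (q + D.commutatorPeriod (fun i => n i)) = F q)
    {w : ℂ} (hw : 0 < w.im) (z : ℂ) : F (w, z) = F (w, 0) := by
  have hw0 : ((w.im * Complex.I : ℂ), (0 : ℂ)) ∈ halfPlaneProdSet := by
    simpa [halfPlaneProdSet] using hw
  let Φ : (Fin 3 → ℝ) → E := fun t => F ((w.im * Complex.I, 0) + D.commutatorPeriod t)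
  have hΦ : Continuous Φ :=
    hF.continuousOn.comp_continuous (continuous_const.add D.continuous_commutatorPeriod)
      fun t => D.commutatorPeriod_add_mem_halfPlaneProdSet hw0 t
  have hdiff : Differentiable ℂ fun z => F (w, z) := by
    intro z
    have h1 : DifferentiableAt ℂ F (w, z) :=
      hF.differentiableAt (isOpen_halfPlaneProdSet.mem_nhds hw)
    exact h1.comp z ((differentiableAt_const w).prodMk differentiableAt_id)
  refine hdiff.apply_eq_apply_of_bounded ?_ z 0
  refine ((isCompact_Icc (a := (0 : Fin 3 → ℝ)) (b := 1)).image hΦ).isBounded.subset ?_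
  rintro _ ⟨z, rfl⟩
  obtain ⟨t, ht⟩ := D.exists_commutatorPeriod_eq w.re z
  -- Dropping integer parts moves the parameter into the unit cube without changing `F`.
  refine ⟨fun i => Int.fract (t i), ⟨fun i => Int.fract_nonneg _, fun i => (Int.fract_lt_one _).le⟩,
    ?_⟩
  have hsplit : t = (fun i => Int.fract (t i)) + fun i => ((⌊t i⌋ : ℤ) : ℝ) := by
    funext i; simp
  simp only [Φ]
  rw [← hper (fun i => ⌊t i⌋) _ (D.commutatorPeriod_add_mem_halfPlaneProdSet hw0 _), add_assoc,
    ← D.commutatorPeriod_add, ← hsplit, ht]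
  congr 1
  refine Prod.ext ?_ ?_
  · simp [add_comm, Complex.re_add_im]
  · simp

/-- A holomorphic function on `ℍ × ℂ` that is periodic for the lattice of the commutators is
constant. -/
theorem periodic_apply_eq_apply (hF : DifferentiableOn ℂ F halfPlaneProdSet)
    (hper : ∀ (n : Fin 3 → ℤ), ∀ q ∈ halfPlaneProdSet,
      F (q + D.commutatorPeriod (fun i => n i)) = F q)
    {q q' : ℂ × ℂ} (hq : q ∈ halfPlaneProdSet) (hq' : q' ∈ halfPlaneProdSet) : F q = F q' := by
  let h : ℂ → E := fun w => F (w, 0)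
  have hopen : IsOpen {w : ℂ | 0 < w.im} := isOpen_lt continuous_const Complex.continuous_im
  have hh : DifferentiableOn ℂ h {w | 0 < w.im} :=
    hF.comp (differentiableOn_id.prodMk (differentiableOn_const 0)) fun w hw => hw
  obtain ⟨c, hc, hn⟩ := D.exists_latticeMap_fst_eq
  choose n hn using hn
  -- First coordinates of periods. The second coordinates are not controlled, which is harmless
  -- since `F` does not depend on `z`.
  let s : ℕ → ℂ := fun k => (((D.α - 1) * ((D.α⁻¹) ^ k * c) : ℝ) : ℂ)
  have hs : ∀ k, D.commutatorPeriod (fun i => n k i) =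
      (s k, (D.β - 1) * (D.latticeMap (fun i => n k i)).2) := fun k => by
    rw [commutatorPeriod, hn]
  have hshift : ∀ w : ℂ, 0 < w.im → ∀ k, h (w + s k) = h w := fun w hw k => by
    have him : 0 < (w + s k).im := by
      rwa [Complex.add_im, Complex.ofReal_im, add_zero]
    have := hper (n k) (w, 0) hw
    rw [hs, Prod.mk_add_mk, periodic_apply_eq_apply_zero hF hper him] at this
    exact this
  have hs0 : Filter.Tendsto s Filter.atTop (nhdsWithin 0 {0}ᶜ) := by
    refine tendsto_nhdsWithin_iff.2 ⟨?_, Filter.Eventually.of_forall fun k => ?_⟩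
    · have h1 : Filter.Tendsto (fun k : ℕ => (D.α - 1) * ((D.α⁻¹) ^ k * c)) Filter.atTop
          (nhds ((D.α - 1) * (0 * c))) :=
        ((tendsto_pow_atTop_nhds_zero_of_lt_one (inv_nonneg.2 D.α_pos.le)
          (inv_lt_one_of_one_lt₀ D.one_lt_α)).mul_const c).const_mul _
      rw [zero_mul, mul_zero] at h1
      exact (Complex.continuous_ofReal.tendsto' 0 0 Complex.ofReal_zero).comp h1
    · have : (D.α - 1) * ((D.α⁻¹) ^ k * c) ≠ 0 :=
        mul_ne_zero D.α_sub_one_ne_zero (mul_ne_zero (pow_ne_zero _ (inv_ne_zero D.α_pos.ne')) hc)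
      simpa only [Set.mem_compl_iff, Set.mem_singleton_iff, s, Complex.ofReal_eq_zero] using this
  -- The difference quotients of `h` along the null sequence `s` all vanish.
  have hderiv : Set.EqOn (deriv h) 0 {w | 0 < w.im} := by
    intro w hw
    have h1 := (hh.differentiableAt (hopen.mem_nhds hw)).hasDerivAt
    have h2 := (hasDerivAt_iff_tendsto_slope_zero.1 h1).comp hs0
    refine tendsto_nhds_unique h2 (tendsto_const_nhds.congr fun k => ?_)
    simp [hshift w hw k]
  have hconst : h q.1 = h q'.1 :=
    hopen.is_const_of_deriv_eq_zero (convex_halfSpace_im_gt 0).isPreconnected hh hderiv hq hq'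
  calc F q = h q.1 := periodic_apply_eq_apply_zero hF hper hq q.2
    _ = h q'.1 := hconst
    _ = F q' := (periodic_apply_eq_apply_zero hF hper hq' q'.2).symm

/-- A holomorphic map on `ℍ × ℂ` that is equivariant up to translations for the lattice of the
commutators is affine. -/
theorem exists_eq_clm_add {U : ℂ × ℂ → E}
    (hU : ContDiffOn ℂ ω U halfPlaneProdSet)
    (hper : ∀ n : Fin 3 → ℤ, ∃ c : E, ∀ q ∈ halfPlaneProdSet,
      U (q + D.commutatorPeriod (fun i => n i)) = U q + c) :
    ∃ (L : ℂ × ℂ →L[ℂ] E) (c : E), ∀ q ∈ halfPlaneProdSet, U q = L q + c := by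
  -- Differentiation removes the constants `c`, so the derivative is truly periodic, hence constant.
  have hF : DifferentiableOn ℂ (fderiv ℂ U) halfPlaneProdSet :=
    (hU.fderiv_of_isOpen (m := 1) isOpen_halfPlaneProdSet le_top).differentiableOn one_ne_zero
  have hFper : ∀ (n : Fin 3 → ℤ), ∀ q ∈ halfPlaneProdSet,
      fderiv ℂ U (q + D.commutatorPeriod (fun i => n i)) = fderiv ℂ U q := by
    intro n q hq
    obtain ⟨c, hc⟩ := hper n
    rw [← fderiv_comp_add_right, ← fderiv_add_const (f := U) c]
    refine Filter.EventuallyEq.fderiv_eq ?_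
    filter_upwards [isOpen_halfPlaneProdSet.mem_nhds hq] with x hx
    exact hc x hx
  have h0 : ((Complex.I, 0) : ℂ × ℂ) ∈ halfPlaneProdSet := by simp [halfPlaneProdSet]
  obtain ⟨c, hc⟩ := isOpen_halfPlaneProdSet.exists_eq_add_of_fderiv_eq
    isPreconnected_halfPlaneProdSet (hU.differentiableOn (by simp))
    (g := fderiv ℂ U (Complex.I, 0)) (ContinuousLinearMap.differentiableOn _)
    (fun q hq => by
      rw [ContinuousLinearMap.fderiv]
      exact periodic_apply_eq_apply hF hFper hq h0)
  exact ⟨_, c, fun q hq => hc hq⟩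

end Periodic
end InoueSMData

/-! ### Elements of the normaliser are affine -/

/-- An automorphism of `ℍ × ℂ` in the coordinates of `ℂ × ℂ`. -/
def coordinateExpr (u : HolAut modelC2 HalfPlaneProd) (q : ℂ × ℂ) : ℂ × ℂ :=
  (((u (UpperHalfPlane.ofComplex q.1, q.2)).1 : ℂ), (u (UpperHalfPlane.ofComplex q.1, q.2)).2)

theorem coordinateExpr_coe (u : HolAut modelC2 HalfPlaneProd) (p : HalfPlaneProd) :
    coordinateExpr u ((p.1 : ℂ), p.2) = (((u p).1 : ℂ), (u p).2) := by
  simp only [coordinateExpr, UpperHalfPlane.ofComplex_apply]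

theorem contDiffOn_coordinateExpr (u : HolAut modelC2 HalfPlaneProd) :
    ContDiffOn ℂ ω (coordinateExpr u) halfPlaneProdSet := by
  intro q hq
  have h1 : ContMDiffAt 𝓘(ℂ, ℂ × ℂ) modelC2 ω
      (fun q : ℂ × ℂ => ((UpperHalfPlane.ofComplex q.1, q.2) : HalfPlaneProd)) q :=
    (ContMDiffAt.comp q (UpperHalfPlane.contMDiffAt_ofComplex hq)
      contDiff_fst.contMDiff.contMDiffAt).prodMk contDiff_snd.contMDiff.contMDiffAt
  have h2 : ContMDiffAt 𝓘(ℂ, ℂ × ℂ) modelC2 ω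
      (fun q : ℂ × ℂ => u (UpperHalfPlane.ofComplex q.1, q.2)) q :=
    ContMDiffAt.comp q u.contMDiff.contMDiffAt h1
  have h3 : ContMDiffAt 𝓘(ℂ, ℂ × ℂ) 𝓘(ℂ) ω (fun q => (coordinateExpr u q).1) q :=
    ContMDiffAt.comp (g := ((↑) : ℍ → ℂ)) q UpperHalfPlane.contMDiff_coe.contMDiffAt
      (ContMDiffAt.comp (g := Prod.fst) q contMDiff_fst.contMDiffAt h2)
  have h4 : ContMDiffAt 𝓘(ℂ, ℂ × ℂ) 𝓘(ℂ) ω (fun q => (coordinateExpr u q).2) q :=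
    ContMDiffAt.comp (g := Prod.snd)
      (f := fun q : ℂ × ℂ => u (UpperHalfPlane.ofComplex q.1, q.2)) q contMDiff_snd.contMDiffAt h2
  exact (h3.contDiffAt.prodMk h4.contDiffAt).contDiffWithinAt

namespace InoueSMData

variable {D : InoueSMData}

/-- Conjugation by `u` carries a commutator in `G_M` to another commutator in `G_M`, which is a
translation because `G_M` is affine. -/
theorem exists_mul_eq_translationAut_mul {u : HolAut modelC2 HalfPlaneProd}
    (hu : u ∈ Subgroup.normalizer (D.deckGroup : Set (HolAut modelC2 HalfPlaneProd)))
    (n : Fin 3 → ℤ) :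
    ∃ (b : ℝ) (B : ℂ),
      u * translationAut ((D.α - 1) * (D.latticeMap (fun i => n i)).1)
        ((D.β - 1) * (D.latticeMap (fun i => n i)).2) = translationAut b B * u := by
  have hconj : ∀ γ ∈ D.deckGroup, u * γ * u⁻¹ ∈ affineSubgroup := fun γ hγ =>
    D.deckGroup_le_affineSubgroup ((Subgroup.mem_normalizer_iff.1 hu γ).1 hγ)
  have hcomm := commutatorElement_affineAut D.α D.α_pos 0 D.β D.β_ne_zero 0 1 one_pos
    (D.latticeMap (fun i => n i)).1 1 one_ne_zero (D.latticeMap (fun i => n i)).2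
  rw [mul_zero, mul_zero, sub_zero, sub_zero] at hcomm
  obtain ⟨b, B, h⟩ := commutatorElement_mem_translationSubgroup (hconj _ D.g₀_mem_deckGroup)
    (hconj _ (D.translationAut_latticeMap_mem_deckGroup n))
  refine ⟨b, B, ?_⟩
  rw [← h, ← hcomm, g₀, translationAut, commutatorElement_def, commutatorElement_def]
  group

theorem exists_coordinateExpr_eq {u : HolAut modelC2 HalfPlaneProd}
    (hu : u ∈ Subgroup.normalizer (D.deckGroup : Set (HolAut modelC2 HalfPlaneProd))) :
    ∃ (L : ℂ × ℂ →L[ℂ] ℂ × ℂ) (c : ℂ × ℂ), ∀ p : HalfPlaneProd,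
      (((u p).1 : ℂ), (u p).2) = L ((p.1 : ℂ), p.2) + c := by
  obtain ⟨L, c, h⟩ := exists_eq_clm_add (D := D) (contDiffOn_coordinateExpr u) fun n => by
    obtain ⟨b, B, hb⟩ := exists_mul_eq_translationAut_mul hu n
    refine ⟨((b : ℂ), B), fun q hq => ?_⟩
    let p : HalfPlaneProd := (⟨q.1, hq⟩, q.2)
    have hq' : q + D.commutatorPeriod (fun i => n i) =
        (((translationAut ((D.α - 1) * (D.latticeMap (fun i => n i)).1)
        ((D.β - 1) * (D.latticeMap (fun i => n i)).2) p).1 : ℂ),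
        (translationAut ((D.α - 1) * (D.latticeMap (fun i => n i)).1)
        ((D.β - 1) * (D.latticeMap (fun i => n i)).2) p).2) := by
      rw [coe_translationAut_fst, translationAut_snd]
      rfl
    rw [hq', coordinateExpr_coe, ← HolAut.mul_apply, hb, HolAut.mul_apply,
      coe_translationAut_fst, translationAut_snd, ← Prod.mk_add_mk, ← coordinateExpr_coe]
  refine ⟨L, c, fun p => ?_⟩
  rw [← h _ p.1.im_pos, coordinateExpr_coe]

theorem mem_affineSubgroup_of_mem_normalizer {u : HolAut modelC2 HalfPlaneProd}
    (hu : u ∈ Subgroup.normalizer (D.deckGroup : Set (HolAut modelC2 HalfPlaneProd))) :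
    u ∈ affineSubgroup := by
  obtain ⟨L, c, hL⟩ := exists_coordinateExpr_eq hu
  obtain ⟨e, C, hL1⟩ : ∃ e C, L (1, 0) = (e, C) := ⟨_, _, rfl⟩
  obtain ⟨f, A, hL2⟩ : ∃ f A, L (0, 1) = (f, A) := ⟨_, _, rfl⟩
  have hLq : ∀ w z : ℂ, L (w, z) = (w * e + z * f, w * C + z * A) := by
    intro w z
    have : ((w, z) : ℂ × ℂ) = w • (1, 0) + z • (0, 1) := by simp
    rw [this, map_add, map_smul, map_smul, hL1, hL2]
    simp
  have hu1 : ∀ (w : ℍ) (z : ℂ), ((u (w, z)).1 : ℂ) = w * e + z * f + c.1 := fun w z => by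
    have := congrArg Prod.fst (hL (w, z))
    rwa [hLq] at this
  have hu2 : ∀ (w : ℍ) (z : ℂ), (u (w, z)).2 = w * C + z * A + c.2 := fun w z => by
    have := congrArg Prod.snd (hL (w, z))
    rwa [hLq] at this
  -- the first component takes values in the half plane
  have hpos : ∀ (w : ℍ) (z : ℂ), 0 < ((w : ℂ) * e + z * f + c.1).im := fun w z => by
    rw [← hu1]
    exact (u (w, z)).1.im_pos
  -- Otherwise some `z` makes the first component 0, which is not in `ℍ`.
  have hf : f = 0 := by
    by_contra hf
    have h := hpos UpperHalfPlane.I (-(UpperHalfPlane.I * e + c.1) / f)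
    rw [div_mul_cancel₀ _ hf] at h
    simp at h
  subst hf
  have hposr : ∀ x y : ℝ, 0 < y → 0 < x * e.im + y * e.re + c.1.im := fun x y hy => by
    have h := hpos ⟨⟨x, y⟩, hy⟩ 0
    simpa [UpperHalfPlane.coe_mk] using h
  -- Otherwise a suitable real part `x` at height 1 makes the image have imaginary part 0.
  have heim : e.im = 0 := by
    by_contra he
    have h := hposr (-(1 * e.re + c.1.im) / e.im) 1 one_pos
    rw [div_mul_cancel₀ _ he] at h
    linarith
  have hposy : ∀ y : ℝ, 0 < y → 0 < y * e.re + c.1.im := fun y hy => by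
    simpa using hposr 0 y hy
  have hsurj : ∀ y : ℝ, 0 < y → ∃ y' : ℝ, 0 < y' ∧ y = y' * e.re + c.1.im := fun y hy => by
    obtain ⟨⟨w, z⟩, hp⟩ : ∃ p, u p = (⟨⟨0, y⟩, hy⟩, 0) := ⟨_, HolAut.apply_inv_self u _⟩
    refine ⟨w.im, w.im_pos, ?_⟩
    have h := congrArg Complex.im (hu1 w z)
    rw [hp] at h
    simpa [heim] using h
  -- Letting `y` tend to 0 gives `0 ≤ c.1.im`. If it were positive, reaching height `c.1.im / 2`
  -- would force `e.re < 0`, and then some positive `y` is sent to height 0.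
  have hcim : c.1.im = 0 := by
    have h0 : 0 ≤ c.1.im := by
      refine le_of_forall_pos_lt_add fun ε hε => ?_
      have h := hposy (ε / (|e.re| + 1)) (by positivity)
      have h2 : ε / (|e.re| + 1) * e.re ≤ ε := by
        rw [div_mul_eq_mul_div, div_le_iff₀ (by positivity)]
        nlinarith [le_abs_self e.re]
      linarith
    by_contra hne
    have hcp : 0 < c.1.im := lt_of_le_of_ne h0 (Ne.symm hne)
    obtain ⟨y, hy, h⟩ := hsurj (c.1.im / 2) (by linarith)
    have he : e.re < 0 := by
      by_contra! he
      nlinarith [mul_nonneg hy.le he]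
    have := hposy (-c.1.im / e.re) (div_pos_of_neg_of_neg (by linarith) he)
    rw [div_mul_cancel₀ _ he.ne] at this
    linarith
  have hepos : 0 < e.re := by
    have := hposy 1 one_pos
    linarith
  have he : e = (e.re : ℂ) := Complex.ext (by simp) (by simp [heim])
  have hc : c.1 = (c.1.re : ℂ) := Complex.ext (by simp) (by simp [hcim])
  -- Otherwise `u` would not depend on `z`, against injectivity.
  have hA : A ≠ 0 := by
    rintro rfl
    have h : u (UpperHalfPlane.I, 0) = u (UpperHalfPlane.I, 1) :=
      Prod.ext (UpperHalfPlane.ext (by rw [hu1, hu1]; simp)) (by rw [hu2, hu2]; simp)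
    have h' := congrArg Prod.snd (u.injective h)
    simp at h'
  -- conjugation of `g₀`
  obtain ⟨a', ha', b', A', hA', B', hg⟩ := D.deckGroup_le_affineSubgroup
    ((Subgroup.mem_normalizer_iff.1 hu _).1 D.g₀_mem_deckGroup)
  rw [mul_inv_eq_iff_eq_mul] at hg
  have hg2 : ∀ (w : ℍ) (z : ℂ), ((D.α : ℂ) * w) * C + (D.β * z) * A + c.2 =
      A' * (w * C + z * A + c.2) + B' := fun w z => by
    have h := congrArg Prod.snd (DFunLike.congr_fun hg (w, z))
    rw [HolAut.mul_apply, HolAut.mul_apply, affineAut_apply] at h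
    have h1 : (u (D.g₀ (w, z))).2 = ((D.g₀ (w, z)).1 : ℂ) * C + (D.g₀ (w, z)).2 * A + c.2 :=
      hu2 _ _
    rw [h1] at h
    simp only [g₀, affineAut_apply, coe_halfPlaneAffine, hu2, Complex.ofReal_zero, add_zero] at h
    exact h
  have hβ : A' = D.β := by
    have h0 := hg2 UpperHalfPlane.I 0
    have h1 := hg2 UpperHalfPlane.I 1
    have : (A' - D.β) * A = 0 := by linear_combination h0 - h1
    exact sub_eq_zero.1 ((mul_eq_zero.1 this).resolve_right hA)
  -- Comparing `w = i` and `w = 2i` gives `(α - β) C = 0`, and `β` is not real.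
  have hC : C = 0 := by
    let w : ℍ := ⟨2 * Complex.I, by simp⟩
    have hw : (w : ℂ) = 2 * Complex.I := rfl
    have h0 := hg2 UpperHalfPlane.I 0
    have h1 := hg2 w 0
    rw [hw] at h1
    rw [UpperHalfPlane.coe_I] at h0
    have h2 : (D.α - A') * (Complex.I * C) = 0 := by linear_combination h1 - h0
    have h3 : (D.α : ℂ) - A' ≠ 0 := by
      rw [hβ]
      refine sub_ne_zero.2 fun h => D.β_ne_conj ?_
      rw [← h, Complex.conj_ofReal]
    simpa [h3] using h2
  refine ⟨e.re, hepos, c.1.re, A, hA, c.2, Diffeomorph.ext fun ⟨w, z⟩ => ?_⟩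
  rw [affineAut_apply]
  refine Prod.ext (UpperHalfPlane.ext ?_) ?_
  · rw [hu1, coe_halfPlaneAffine, ← he, ← hc]
    ring
  · rw [hu2, hC]
    ring

end InoueSMData

/-! ### Derived series and conclusion -/

theorem derivedSeries_eq_bot_of_injective {G G' : Type*} [Group G] [Group G'] {f : G →* G'}
    (hf : Function.Injective f) {n : ℕ} (h : derivedSeries G' n = ⊥) : derivedSeries G n = ⊥ := by
  have := map_derivedSeries_le_derivedSeries f n
  rwa [h, le_bot_iff, Subgroup.map_eq_bot_iff_of_injective _ hf] at this

theorem virtualDerivedLength_le_of_derivedSeries_eq_bot {G : Type*} [Group G] {n : ℕ}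
    (h : derivedSeries G n = ⊥) : virtualDerivedLength G ≤ n :=
  calc virtualDerivedLength G ≤ derivedLength (⊤ : Subgroup G) :=
        iInf₂_le (f := fun (H : Subgroup G) (_ : H.FiniteIndex) => derivedLength H) ⊤
          inferInstance
    _ ≤ n := iInf₂_le (f := fun (n : ℕ) (_ : derivedSeries (⊤ : Subgroup G) n = ⊥) => (n : ℕ∞)) n
        (derivedSeries_eq_bot_of_injective (⊤ : Subgroup G).subtype_injective h)

namespace InoueSMData

variable {D : InoueSMData}

theorem IsLift.mem_affineSubgroup {u : HolAut modelC2 HalfPlaneProd} {f : D.Aut}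
    (hu : D.IsLift u f) : u ∈ affineSubgroup :=
  mem_affineSubgroup_of_mem_normalizer hu.mem_normalizer

theorem IsLift.commutatorElement {u v : HolAut modelC2 HalfPlaneProd} {f g : D.Aut}
    (hu : D.IsLift u f) (hv : D.IsLift v g) : D.IsLift ⁅u, v⁆ ⁅f, g⁆ :=
  ((hu.mul hv).mul hu.inv).mul hv.inv

variable (D)

/-- The automorphisms of `X` that lift to a translation of `ℍ × ℂ`. -/
def autTranslationSubgroup : Subgroup D.Aut where
  carrier := {f | ∃ u ∈ translationSubgroup, D.IsLift u f}
  one_mem' := ⟨1, one_mem _, fun _ => rfl⟩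
  mul_mem' := by
    rintro f g ⟨u, hu, huf⟩ ⟨v, hv, hvg⟩
    exact ⟨u * v, mul_mem hu hv, huf.mul hvg⟩
  inv_mem' := by
    rintro f ⟨u, hu, huf⟩
    exact ⟨u⁻¹, inv_mem hu, huf.inv⟩

/-- A commutator in `Aut(X)` is lifted by the commutator of lifts, which is a translation.
Translations commute, so a commutator of two such elements is lifted by the identity. -/
theorem derivedSeries_aut_two : derivedSeries D.Aut 2 = ⊥ := by
  have h1 : derivedSeries D.Aut 1 ≤ D.autTranslationSubgroup := by
    rw [derivedSeries_succ, Subgroup.commutator_le]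
    intro f _ g _
    obtain ⟨u, hu⟩ := D.exists_isLift f
    obtain ⟨v, hv⟩ := D.exists_isLift g
    exact ⟨_, commutatorElement_mem_translationSubgroup hu.mem_affineSubgroup
      hv.mem_affineSubgroup, hu.commutatorElement hv⟩
  rw [derivedSeries_succ, eq_bot_iff, Subgroup.commutator_le]
  intro f hf g hg
  obtain ⟨u, hu, huf⟩ := h1 hf
  obtain ⟨v, hv, hvg⟩ := h1 hg
  have h := huf.commutatorElement hvg
  rw [commutatorElement_eq_one_of_mem_translationSubgroup hu hv] at h
  exact Subgroup.mem_bot.2 h.eq_one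

end InoueSMData

end

theorem theorem6p1 (D : InoueSMData) :
    -- `Aut(X)` is solvable
    Group.IsSolvable D.Aut ∧
    -- every subgroup of `Aut(X)` has virtual derived length at most `2`
    (∀ G : Subgroup D.Aut, virtualDerivedLength G ≤ 2) ∧
    -- every automorphism of `X` lifts to an automorphism of `ℍ × ℂ`
    (∀ f : D.Aut, ∃ u : HolAut modelC2 HalfPlaneProd, D.IsLift u f) ∧
    -- the automorphisms of `ℍ × ℂ` that are lifts are exactly those normalising `G_M`
    (∀ u : HolAut modelC2 HalfPlaneProd, (∃ f : D.Aut, D.IsLift u f) ↔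
      u ∈ Subgroup.normalizer (D.deckGroup : Set (HolAut modelC2 HalfPlaneProd))) ∧
    -- every lift is an affine map `(w, z) ↦ (a w + b, A z + B)`
    (∀ (u : HolAut modelC2 HalfPlaneProd) (f : D.Aut), D.IsLift u f →
      ∃ (a : ℝ) (ha : 0 < a) (b : ℝ) (A : ℂ) (hA : A ≠ 0) (B : ℂ),
        u = affineAut a ha b A hA B) := by
  have h2 := D.derivedSeries_aut_two
  exact ⟨⟨2, h2⟩, fun G => virtualDerivedLength_le_of_derivedSeries_eq_bot
    (derivedSeries_eq_bot_of_injective G.subtype_injective h2), D.exists_isLift,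
    fun u => ⟨fun ⟨_, hf⟩ => hf.mem_normalizer, InoueSMData.exists_isLift_of_mem_normalizer⟩,
    fun u f hu => hu.mem_affineSubgroup⟩
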